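/- A continuous map $f:X\to Y$ between finite $T_0$-spaces is called distinguished if for every $y\in Y$ the preimage $f^{-1}(U_y)$ is contractible, where $U_y$ is the intersection of all open subsets of $Y$ containing $y$. Let $\mathcal{D}$ be the class of distinguished maps and let $\overline{\mathcal{D}}$ be the smallest class of continuous maps between finite $T_0$-spaces that contains $\mathcal{D}$ and has the 2-of-3 property up to homotopy: whenever $fg\simeq h$ and two of the maps $f,g,h$ belong to the class, so does the third. For a finite simplicial complex $K$, let $|K|$ be its geometric realization and let $\mathcal{X}(K)$ be the finite $T_0$-space whose points are the (non-empty) simplices of $K$ and whose open sets are the sets of simplices closed under passing to faces. A simplicial map $\varphi:K\to L$ induces the continuous maps $|\varphi|:|K|\to|L|$ and $\mathcal{X}(\varphi):\mathcal{X}(K)\to\mathcal{X}(L)$, $S\mapsto\varphi(S)$. Theorem. Let $n\ge 0$, let $K_0,K_1,\ldots,K_n$ be finite simplicial complexes and let $f_i:|K_i|\to|K_{i+1}|$ $(0\le i<n)$ be continuous maps such that for each $0\le i<n$ one of the following holds: (1) $f_i=|\varphi_i|$, where $\varphi_i:K_i\to K_{i+1}$ is a simplicial map such that $\mathcal{X}(\varphi_i)\in\overline{\mathcal{D}}$;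 (2) $f_i$ is a homotopy inverse of $|\varphi_i|$, where $\varphi_i:K_{i+1}\to K_i$ is a simplicial map such that $\mathcal{X}(\varphi_i)\in\overline{\mathcal{D}}$. Let $\varphi:K_0\to K_n$ be a simplicial map such that $|\varphi|\simeq f_{n-1}f_{n-2}\cdots f_0$ (the identity of $|K_0|$ if $n=0$). Then $\mathcal{X}(\varphi)\in\overline{\mathcal{D}}$. -/

import Mathlib

universe u

/-! ### Finite T₀-spaces and the class generated by the distinguished maps -/

/-- A finite `T₀`-space. -/
structure FinT0Space : Type (u + 1) where
  carrier : Type u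
  [top : TopologicalSpace carrier]
  [fin : Finite carrier]
  [t0 : T0Space carrier]

namespace FinT0Space

instance : CoeSort FinT0Space.{u} (Type u) := ⟨FinT0Space.carrier⟩

attribute [instance] FinT0Space.top FinT0Space.fin FinT0Space.t0

end FinT0Space

/-- A class of continuous maps between finite `T₀`-spaces. -/
abbrev MapClass : Type (u + 1) := ∀ ⦃X Y : FinT0Space.{u}⦄, C(X, Y) → Prop

/-- The minimal open set `U_y`: the intersection of all open sets containing `y`. -/
def minOpen {X : Type*} [TopologicalSpace X] (y : X) : Set X :=
  ⋂₀ {U : Set X | IsOpen U ∧ y ∈ U}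

/-- The class `𝒟` of distinguished maps: `f⁻¹(U_y)` is contractible for every point `y` of the
target. -/
def Distinguished : MapClass.{u} := fun _ Y f =>
  ∀ y : Y, ContractibleSpace (f ⁻¹' minOpen y)

/-- The class generated by `𝒞`: the smallest class of maps between finite `T₀`-spaces which
contains `𝒞` and has the 2-of-3 property up to homotopy, i.e. whenever `f g ≃ h` and two of the
three maps `f`, `g`, `h` are in the class, so is the third one. -/
inductive Generated (C : MapClass.{u}) : MapClass.{u}
  | basic {X Y : FinT0Space.{u}} {f : C(X, Y)} (hf : C f) : Generated C f
  | comp {X Y Z : FinT0Space.{u}} {f : C(Y, Z)} {g : C(X, Y)} {h : C(X, Z)}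
      (e : (f.comp g).Homotopic h) (hf : Generated C f) (hg : Generated C g) : Generated C h
  | left {X Y Z : FinT0Space.{u}} {f : C(Y, Z)} {g : C(X, Y)} {h : C(X, Z)}
      (e : (f.comp g).Homotopic h) (hg : Generated C g) (hh : Generated C h) : Generated C f
  | right {X Y Z : FinT0Space.{u}} {f : C(Y, Z)} {g : C(X, Y)} {h : C(X, Z)}
      (e : (f.comp g).Homotopic h) (hf : Generated C f) (hh : Generated C h) : Generated C g

/-- The class `𝒟̄` generated by the distinguished maps. -/
def DBar : MapClass.{u} := Generated Distinguished

/-! ### Finite simplicial complexes and simplicial maps -/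

/-- A finite simplicial complex: a finite set of vertices with a set of nonempty finite subsets,
the simplices, which contains all singletons and all nonempty subsets of its members. -/
structure FinSimplicialComplex : Type (u + 1) where
  Vertex : Type u
  [fintypeVertex : Fintype Vertex]
  toComplex : AbstractSimplicialComplex Vertex

namespace FinSimplicialComplex

attribute [instance] FinSimplicialComplex.fintypeVertex

/-- The type of simplices of `K`; it is ordered by inclusion. -/
abbrev Simplex (K : FinSimplicialComplex.{u}) : Type u :=
  {s : Finset K.Vertex // s ∈ K.toComplex}

/-- The geometric realization `|K|`: the points of the standard simplex on the vertices of `K`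
(with the Euclidean topology) whose support is contained in a simplex of `K`. -/
abbrev Realization (K : FinSimplicialComplex.{u}) : Type u :=
  {x : stdSimplex ℝ K.Vertex // ∃ s ∈ K.toComplex, ∀ v, x v ≠ 0 → v ∈ s}

/-- The finite space `𝒳(K)`: the poset of simplices of `K`, ordered by inclusion, with the topology
whose open sets are the lower sets (so that `U_S` is the set of all simplices contained in `S`). -/
def faceSpace (K : FinSimplicialComplex.{u}) : FinT0Space.{u} where
  carrier := Topology.WithLowerSet K.Simplex
  fin := inferInstanceAs (Finite K.Simplex)
  t0 := ⟨fun _ _ h => le_antisymm (α := K.Simplex)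
    (Topology.WithLowerSet.ofLowerSet_le_ofLowerSet.2 h.specializes)
    (Topology.WithLowerSet.ofLowerSet_le_ofLowerSet.2 h.symm.specializes)⟩

end FinSimplicialComplex

open Classical in
/-- A simplicial map: a map on vertices which sends simplices to simplices. -/
structure SimplicialMap (K L : FinSimplicialComplex.{u}) where
  toFun : K.Vertex → L.Vertex
  image_mem : ∀ s ∈ K.toComplex, s.image toFun ∈ L.toComplex

namespace SimplicialMap

variable {K L : FinSimplicialComplex.{u}}

theorem map_support (φ : SimplicialMap K L) (x : K.Realization) :
    ∃ t ∈ L.toComplex, ∀ w, stdSimplex.map φ.toFun x.1 w ≠ 0 → w ∈ t := by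
  classical
  obtain ⟨s, hs, hx⟩ := x.2
  refine ⟨s.image φ.toFun, by convert φ.image_mem s hs, fun w hw => ?_⟩
  rw [stdSimplex.map_coe, FunOnFinite.linearMap_apply_apply] at hw
  obtain ⟨v, hv, hne⟩ := Finset.exists_ne_zero_of_sum_ne_zero hw
  rw [Finset.mem_filter] at hv
  exact Finset.mem_image.2 ⟨v, hx v hne, hv.2⟩

/-- The map `|φ| : |K| → |L|` which extends `φ` linearly on each simplex. -/
noncomputable def realization (φ : SimplicialMap K L) : C(K.Realization, L.Realization) where
  toFun x := ⟨stdSimplex.map φ.toFun x.1, φ.map_support x⟩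
  continuous_toFun :=
    ((stdSimplex.continuous_map φ.toFun).comp continuous_subtype_val).subtype_mk _

open Classical in
/-- The map `𝒳(φ) : 𝒳(K) → 𝒳(L)`, `S ↦ φ(S)`. -/
noncomputable def faceMap (φ : SimplicialMap K L) : C(K.faceSpace, L.faceSpace) :=
  Topology.WithLowerSet.map (α := K.Simplex) (β := L.Simplex)
    { toFun := fun s => ⟨s.1.image φ.toFun, φ.image_mem s.1 s.2⟩
      monotone' := fun _ _ h => Finset.image_subset_image h }

end SimplicialMap

/-! ### Homotopy inverses and composites of finite sequences of maps -/

/-- `f` and `g` are homotopy inverse to each other. -/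
def IsHomotopyInverse {X Y : Type*} [TopologicalSpace X] [TopologicalSpace Y]
    (f : C(X, Y)) (g : C(Y, X)) : Prop :=
  (f.comp g).Homotopic (ContinuousMap.id Y) ∧ (g.comp f).Homotopic (ContinuousMap.id X)

/-- The composite `f_{n-1} ⋯ f_1 f_0 : X_0 → X_n` of maps `f_i : X_i → X_{i+1}`, `0 ≤ i < n`
(the identity if `n = 0`). -/
def chainComp : ∀ (n : ℕ) (X : Fin (n + 1) → Type u) [∀ i, TopologicalSpace (X i)],
    (∀ i : Fin n, C(X i.castSucc, X i.succ)) → C(X 0, X (Fin.last n))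
  | 0, _, _, _ => ContinuousMap.id _
  | n + 1, X, _, f =>
      (f (Fin.last n)).comp
        (chainComp n (fun i : Fin (n + 1) => X i.castSucc) (fun i : Fin n => f i.castSucc))

/-! Membership of `𝒳(ψ)` in `𝒟̄` is extended from simplicial maps to arbitrary continuous maps `f :
|K| → |L|` in a homotopy invariant way. `HasDBarApprox f` asks for some `h : |P| → |K|`,
approximated by a simplicial map with face map in `𝒟̄`, and a simplicial approximation `ψ` of `f ∘
h` with `𝒳(ψ)` in `𝒟̄`.

Two simplicial approximations of one map are contiguous, and contiguous maps induce homotopic maps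
of face spaces. By 2-of-3 the choice of `P` is then immaterial, and a simplicial approximation of
`f` itself has face map in `𝒟̄` as soon as `HasDBarApprox f` holds (`HasDBarApprox.dbar`).

Passing from `K` to its barycentric subdivision costs nothing, since the vertex map `K' → K` has
face map in `𝒟̄` (`dbar_vertexMap`). Iterated subdivisions have arbitrarily small mesh, so nearby
maps acquire a common approximation. Hence the property is locally constant along a homotopy, and
constant by connectedness of the interval (`HasDBarApprox.of_homotopic`).

Finally, the property survives composition with each allowed `f_i`; for a homotopy inverse this is
cancellation by 2-of-3. The linear maps `|K'| → |K|` are never needed to be homeomorphisms: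
linearity and small mesh suffice. -/

/-! ### Homotopies between maps of finite spaces -/

/-- A map which is pointwise below another one in the specialization preorder is homotopic
to it. -/
theorem ContinuousMap.homotopic_of_specializes {X Y : Type*} [TopologicalSpace X]
    [TopologicalSpace Y] (f g : C(X, Y)) (h : ∀ x, f x ⤳ g x) : f.Homotopic g := by
  classical
  -- The homotopy equals `f` for `t ≠ 1` and jumps to `g` at `t = 1`. It is continuous because every
  -- open set containing `g x` contains `f x`.
  let s : Set (unitInterval × X) := {p | p.1 ≠ 1}
  have hs : IsOpen s := isOpen_ne_fun continuous_fst continuous_const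
  exact ⟨{
    toFun := s.piecewise (fun p => f p.2) (fun p => g p.2)
    continuous_toFun := hs.continuous_piecewise_of_specializes
      (f.continuous.comp continuous_snd) (g.continuous.comp continuous_snd) fun p => h p.2
    map_zero_left := fun x => Set.piecewise_eq_of_mem _ _ _ (by simp [s])
    map_one_left := fun x => Set.piecewise_eq_of_notMem _ _ _ (by simp [s]) }⟩

theorem continuous_of_map_specializes {X Y : Type*} [TopologicalSpace X] [TopologicalSpace Y]
    [AlexandrovDiscrete X] {f : X → Y} (h : ∀ x y, x ⤳ y → f x ⤳ f y) : Continuous f :=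
  continuous_def.2 fun _ hU => isOpen_iff_forall_specializes.2 fun x y hxy hy =>
    (h x y hxy).mem_open hU hy

theorem mem_minOpen {X : Type*} [TopologicalSpace X] {x y : X} : x ∈ minOpen y ↔ x ⤳ y := by
  simp [minOpen, specializes_iff_forall_open]

/-- A space `X` is contractible if there are a continuous `g : X → X` and a point `a` such that
`x ≤ g x ≥ a` for all `x`. -/
theorem contractibleSpace_of_specializes {X : Type*} [TopologicalSpace X] (g : C(X, X)) (a : X)
    (h : ∀ x, x ⤳ g x) (ha : ∀ x, a ⤳ g x) : ContractibleSpace X :=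
  (contractible_iff_id_nullhomotopic X).2 ⟨a,
    (ContinuousMap.homotopic_of_specializes (.id X) g h).trans
      (ContinuousMap.homotopic_of_specializes (.const X a) g ha).symm⟩

namespace DBar

variable {X Y Z : FinT0Space.{u}}

theorem id (X : FinT0Space.{u}) : DBar (ContinuousMap.id X) := .basic fun y => by
  let a : (ContinuousMap.id X) ⁻¹' minOpen y := ⟨y, mem_minOpen.2 specializes_rfl⟩
  have h : ∀ x, x ⤳ a := fun x => (subtype_specializes_iff _ _).2 (mem_minOpen.1 x.2)
  exact contractibleSpace_of_specializes (.const _ a) a h fun _ => specializes_rfl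

theorem of_homotopic {f g : C(X, Y)} (hf : DBar f) (h : f.Homotopic g) : DBar g :=
  .comp (g := .id _) h hf (id X)

theorem comp {f : C(Y, Z)} {g : C(X, Y)} (hf : DBar f) (hg : DBar g) : DBar (f.comp g) :=
  Generated.comp (.refl _) hf hg

theorem of_comp_left {f : C(Y, Z)} {g : C(X, Y)} (hg : DBar g) (h : DBar (f.comp g)) : DBar f :=
  Generated.left (.refl _) hg h

theorem of_comp_right {f : C(Y, Z)} {g : C(X, Y)} (hf : DBar f) (h : DBar (f.comp g)) :
    DBar g :=
  Generated.right (.refl _) hf h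

end DBar

/-! ### Simplicial maps -/

namespace FinSimplicialComplex

variable {K : FinSimplicialComplex.{u}}

theorem nonempty_of_mem {s : Finset K.Vertex} (hs : s ∈ K.toComplex) : s.Nonempty :=
  (K.toComplex.isRelLowerSet_faces hs).1

theorem mem_of_subset {s t : Finset K.Vertex} (hs : s ∈ K.toComplex) (h : t ⊆ s)
    (ht : t.Nonempty) : t ∈ K.toComplex :=
  (K.toComplex.isRelLowerSet_faces hs).2 h ht

/-- The point of `𝒳(K)` given by a simplex. -/
def toFace (s : K.Simplex) : K.faceSpace := Topology.WithLowerSet.toLowerSet s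

/-- The simplex given by a point of `𝒳(K)`. -/
def ofFace (s : K.faceSpace) : K.Simplex := Topology.WithLowerSet.ofLowerSet (α := K.Simplex) s

theorem specializes_faceSpace {s t : K.faceSpace} : s ⤳ t ↔ (ofFace s).1 ⊆ (ofFace t).1 :=
  (Topology.WithLowerSet.ofLowerSet_le_ofLowerSet (α := K.Simplex) (a := s) (b := t)).symm

theorem ofFace_injective : Function.Injective (ofFace (K := K)) := fun _ _ h => h

end FinSimplicialComplex

namespace SimplicialMap

open FinSimplicialComplex (ofFace)

variable {K L M : FinSimplicialComplex.{u}}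

/-- The identity simplicial map. -/
def id (K : FinSimplicialComplex.{u}) : SimplicialMap K K where
  toFun := _root_.id
  image_mem s hs := by simpa using hs

/-- The composite of two simplicial maps. -/
def comp (ψ : SimplicialMap L M) (φ : SimplicialMap K L) : SimplicialMap K M where
  toFun := ψ.toFun ∘ φ.toFun
  image_mem s hs := by
    classical
    have := ψ.image_mem _ (φ.image_mem s hs)
    rw [Finset.image_image] at this
    exact this

theorem faceMap_id (K : FinSimplicialComplex.{u}) :
    (id K).faceMap = ContinuousMap.id K.faceSpace := by
  classical
  ext s
  exact FinSimplicialComplex.ofFace_injective (Subtype.ext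
    (Finset.image_id (s := (ofFace s).1)))

theorem faceMap_comp (ψ : SimplicialMap L M) (φ : SimplicialMap K L) :
    (ψ.comp φ).faceMap = ψ.faceMap.comp φ.faceMap := by
  classical
  ext s
  exact FinSimplicialComplex.ofFace_injective (Subtype.ext
    (Finset.image_image (s := (ofFace s).1) (f := φ.toFun) (g := ψ.toFun)).symm)

open Classical in
/-- Contiguous simplicial maps induce homotopic maps of face spaces. -/
theorem faceMap_homotopic_of_contiguous (φ ψ : SimplicialMap K L)
    (h : ∀ s ∈ K.toComplex, s.image φ.toFun ∪ s.image ψ.toFun ∈ L.toComplex) :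
    φ.faceMap.Homotopic ψ.faceMap := by
  let g : C(K.faceSpace, L.faceSpace) :=
    Topology.WithLowerSet.map (α := K.Simplex) (β := L.Simplex)
      { toFun := fun s => ⟨s.1.image φ.toFun ∪ s.1.image ψ.toFun, h s.1 s.2⟩
        monotone' := fun _ _ h => Finset.union_subset_union (Finset.image_subset_image h)
          (Finset.image_subset_image h) }
  refine (ContinuousMap.homotopic_of_specializes _ g fun s => ?_).trans
    (ContinuousMap.homotopic_of_specializes _ g fun s => ?_).symm
  · exact FinSimplicialComplex.specializes_faceSpace.2 Finset.subset_union_left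
  · exact FinSimplicialComplex.specializes_faceSpace.2 Finset.subset_union_right

theorem dbar_comp_iff {ψ : SimplicialMap L M} {φ : SimplicialMap K L} (hφ : DBar φ.faceMap) :
    DBar (ψ.comp φ).faceMap ↔ DBar ψ.faceMap := by
  rw [faceMap_comp]
  exact ⟨fun h => .of_comp_left hφ h, fun h => .comp h hφ⟩

end SimplicialMap

/-! ### The barycentric subdivision -/

namespace FinSimplicialComplex

variable (K : FinSimplicialComplex.{u})

noncomputable instance : Fintype K.Simplex := Fintype.ofFinite _

/-- The barycentric subdivision: the simplices are the nonempty chains of simplices of `K`. -/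
noncomputable abbrev subdivision : FinSimplicialComplex.{u} where
  Vertex := K.Simplex
  toComplex :=
    { faces := {c | c.Nonempty ∧ IsChain (· ≤ ·) (c : Set K.Simplex)}
      isRelLowerSet_faces := fun _ hc =>
        ⟨hc.1, fun _ h ht => ⟨ht, hc.2.mono (Finset.coe_subset.2 h)⟩⟩
      singleton_mem := fun v => by simp }

variable {K}

theorem mem_subdivision {c : Finset K.Simplex} :
    c ∈ K.subdivision.toComplex ↔ c.Nonempty ∧ IsChain (· ≤ ·) (c : Set K.Simplex) := Iff.rfl

theorem exists_max_of_mem_subdivision {c : Finset K.Simplex} (hc : c ∈ K.subdivision.toComplex) :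
    ∃ s ∈ c, ∀ t ∈ c, t ≤ s := by
  obtain ⟨s, hs⟩ := c.exists_maximal hc.1
  exact ⟨s, hs.1, fun t ht => (hc.2.total ht hs.1).elim _root_.id (hs.2 ht)⟩

open Classical in
theorem sup_mem_of_mem_subdivision {c : Finset K.Simplex} (hc : c ∈ K.subdivision.toComplex) :
    c.sup Subtype.val ∈ K.toComplex := by
  obtain ⟨s, hs, h⟩ := exists_max_of_mem_subdivision hc
  rw [le_antisymm (Finset.sup_le h) (Finset.le_sup hs)]
  exact s.2

open Classical in
/-- The map `𝒳(K') → 𝒳(K)` which sends a chain of simplices to its maximum. -/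
noncomputable def maxMap (K : FinSimplicialComplex.{u}) :
    C(K.subdivision.faceSpace, K.faceSpace) where
  toFun c := toFace ⟨(ofFace c).1.sup Subtype.val, sup_mem_of_mem_subdivision (ofFace c).2⟩
  continuous_toFun := continuous_of_map_specializes fun _ _ h =>
    specializes_faceSpace.2 (Finset.sup_mono (specializes_faceSpace.1 h))

theorem maxMap_mem_minOpen {c : K.subdivision.faceSpace} {s : K.faceSpace} :
    K.maxMap c ∈ minOpen s ↔ ∀ t ∈ (ofFace c).1, t ≤ ofFace s := by
  classical
  rw [mem_minOpen, specializes_faceSpace]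
  exact Finset.sup_le_iff

/-- The preimage of `U_S` consists of the chains `c` whose members all lie in `S`. Adding `S` keeps
such a set a chain, so `c ≤ c ∪ {S} ≥ {S}` contracts the preimage to `{S}`. -/
theorem distinguished_maxMap (K : FinSimplicialComplex.{u}) : Distinguished K.maxMap := by
  classical
  intro s
  let A := K.maxMap ⁻¹' minOpen s
  have hA : ∀ c : A, ∀ t ∈ (ofFace c.1).1, t ≤ ofFace s := fun c => maxMap_mem_minOpen.1 c.2
  let a : A := ⟨toFace ⟨{ofFace s}, K.subdivision.toComplex.singleton_mem (ofFace s)⟩,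
    maxMap_mem_minOpen.2 fun t ht => (Finset.mem_singleton.1 ht).le⟩
  have hg : ∀ c : A, insert (ofFace s) (ofFace c.1).1 ∈ K.subdivision.toComplex := fun c =>
    mem_subdivision.2 ⟨Finset.insert_nonempty _ _, by
      rw [Finset.coe_insert]
      exact (ofFace c.1).2.2.insert fun t ht _ => Or.inr (hA c t ht)⟩
  let g : A → A := fun c => ⟨toFace ⟨insert (ofFace s) (ofFace c.1).1, hg c⟩,
    maxMap_mem_minOpen.2 fun t ht =>
      (Finset.mem_insert.1 ht).elim (fun h => h.le) (hA c t)⟩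
  have hgc : Continuous g := continuous_of_map_specializes fun x y hxy =>
    (subtype_specializes_iff _ _).2 (specializes_faceSpace.2 (Finset.insert_subset_insert _
      (specializes_faceSpace.1 ((subtype_specializes_iff _ _).1 hxy))))
  refine contractibleSpace_of_specializes (X := A) ⟨g, hgc⟩ a (fun c => ?_) fun c => ?_
  · exact (subtype_specializes_iff _ _).2 (specializes_faceSpace.2 (Finset.subset_insert _ _))
  · exact (subtype_specializes_iff _ _).2 (specializes_faceSpace.2
      (Finset.singleton_subset_iff.2 (Finset.mem_insert_self _ _)))

/-- A simplicial map from the subdivision of `K` to `K` which approximates the identity: it sends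
each simplex to one of its vertices. -/
noncomputable def vertexMap (K : FinSimplicialComplex.{u}) : SimplicialMap K.subdivision K where
  toFun s := (nonempty_of_mem s.2).choose
  image_mem c hc := by
    classical
    refine mem_of_subset (sup_mem_of_mem_subdivision hc) ?_ (hc.1.image _)
    refine Finset.image_subset_iff.2 fun s hs => ?_
    exact Finset.le_sup (f := Subtype.val) hs (nonempty_of_mem s.2).choose_spec

theorem vertexMap_mem (s : K.Simplex) : K.vertexMap.toFun s ∈ s.1 :=
  (nonempty_of_mem s.2).choose_spec

/-- The chosen vertices of the members of a chain all lie in its maximum, so this map is pointwise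
below the distinguished map `maxMap`. -/
theorem dbar_vertexMap (K : FinSimplicialComplex.{u}) : DBar K.vertexMap.faceMap := by
  classical
  refine DBar.of_homotopic (.basic K.distinguished_maxMap)
    (ContinuousMap.homotopic_of_specializes _ _ fun c => ?_).symm
  refine specializes_faceSpace.2 (Finset.image_subset_iff.2 fun s hs => ?_)
  change _ ∈ (ofFace c).1.sup Subtype.val
  exact Finset.le_sup (f := Subtype.val) hs (vertexMap_mem s)

end FinSimplicialComplex

/-! ### Simplicial approximation -/

namespace FinSimplicialComplex

variable {K : FinSimplicialComplex.{u}}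

open Classical in
/-- The barycenter of a simplex. -/
noncomputable def barycenter (s : K.Simplex) : K.Realization :=
  ⟨⟨fun v => if v ∈ s.1 then (s.1.card : ℝ)⁻¹ else 0, fun v => by positivity, by
    have := (nonempty_of_mem s.2).card_pos
    rw [Finset.sum_ite_mem, Finset.univ_inter, Finset.sum_const, nsmul_eq_mul,
      mul_inv_cancel₀ (by positivity)]⟩,
    s.1, s.2, fun v hv => by
      by_contra h
      exact hv (if_neg h)⟩

open Classical in
theorem barycenter_apply (s : K.Simplex) (v : K.Vertex) :
    (barycenter s).1 v = if v ∈ s.1 then (s.1.card : ℝ)⁻¹ else 0 := rfl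

theorem barycenter_ne_zero {s : K.Simplex} {v : K.Vertex} (hv : v ∈ s.1) :
    (barycenter s).1 v ≠ 0 := by
  rw [barycenter_apply, if_pos hv]
  exact inv_ne_zero (Nat.cast_ne_zero.2 (Finset.card_ne_zero_of_mem hv))

/-- The points of `|K|` which are nonzero on `t` form a simplex. -/
theorem mem_of_forall_ne_zero (x : K.Realization) {t : Finset K.Vertex} (ht : t.Nonempty)
    (h : ∀ v ∈ t, x.1 v ≠ 0) : t ∈ K.toComplex := by
  obtain ⟨s, hs, hx⟩ := x.2
  exact mem_of_subset hs (fun v hv => hx v (h v hv)) ht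

/-- The open star of a vertex. -/
def openStar (v : K.Vertex) : Set K.Realization := {x | x.1 v ≠ 0}

theorem continuous_coord (v : K.Vertex) : Continuous fun x : K.Realization => x.1 v :=
  (continuous_apply v).comp (continuous_subtype_val.comp continuous_subtype_val)

theorem isOpen_openStar (v : K.Vertex) : IsOpen (openStar v) :=
  isOpen_ne_fun (continuous_coord v) continuous_const

theorem exists_mem_openStar (x : K.Realization) : ∃ v, x ∈ openStar v := by
  by_contra! h
  have := stdSimplex.sum_eq_one x.1
  rw [Finset.sum_eq_zero fun v _ => not_not.1 (h v)] at this
  exact zero_ne_one this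

/-- Compactness supplies Lebesgue numbers and the uniform metric on `C(|K|, |L|)`. The realization
is a finite union of closed faces of the standard simplex. -/
instance : CompactSpace K.Realization := by
  classical
  refine isCompact_iff_compactSpace.1 (IsClosed.isCompact
    (s := {x : stdSimplex ℝ K.Vertex | ∃ s ∈ K.toComplex, ∀ v, x v ≠ 0 → v ∈ s}) ?_)
  have : {x : stdSimplex ℝ K.Vertex | ∃ s ∈ K.toComplex, ∀ v, x v ≠ 0 → v ∈ s} =
      ⋃ s ∈ {s | s ∈ K.toComplex}, ⋂ v ∈ {v | v ∉ s}, {x : stdSimplex ℝ K.Vertex | x v = 0} := by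
    ext x
    simp only [Set.mem_ofPred_eq, Set.mem_iUnion, Set.mem_iInter, exists_prop]
    exact exists_congr fun s => and_congr_right fun _ => forall_congr' fun v =>
      not_imp_comm
  rw [this]
  exact (Set.toFinite _).isClosed_biUnion fun s _ => isClosed_biInter fun v _ =>
    isClosed_eq ((continuous_apply v).comp continuous_subtype_val) continuous_const

end FinSimplicialComplex

open FinSimplicialComplex

variable {K L M : FinSimplicialComplex.{u}}

/-- `ψ` is a simplicial approximation of `f`: the support of `f x` contains the image under `ψ` of
the support of `x`. -/
def Approximates (ψ : SimplicialMap K L) (f : C(K.Realization, L.Realization)) : Prop :=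
  ∀ x v, x.1 v ≠ 0 → (f x).1 (ψ.toFun v) ≠ 0

namespace Approximates

theorem id (K : FinSimplicialComplex.{u}) : Approximates (.id K) (.id K.Realization) :=
  fun _ _ h => h

theorem comp {ψ : SimplicialMap L M} {g : C(L.Realization, M.Realization)}
    {φ : SimplicialMap K L} {f : C(K.Realization, L.Realization)} (hg : Approximates ψ g)
    (hf : Approximates φ f) : Approximates (ψ.comp φ) (g.comp f) :=
  fun x v h => hg (f x) _ (hf x v h)

theorem realization (φ : SimplicialMap K L) : Approximates φ φ.realization := by
  classical
  intro x v hv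
  change stdSimplex.map φ.toFun x.1 (φ.toFun v) ≠ 0
  rw [stdSimplex.map_coe, FunOnFinite.linearMap_apply_apply]
  refine (Finset.sum_pos' (fun w _ => stdSimplex.zero_le _ _) ⟨v, by simp, ?_⟩).ne'
  exact lt_of_le_of_ne (stdSimplex.zero_le _ _) hv.symm

/-- The support of `f` at the barycenter of `s` contains both `φ(s)` and `ψ(s)`, so their union is a
simplex and `φ`, `ψ` are contiguous. -/
theorem faceMap_homotopic {φ ψ : SimplicialMap K L} {f : C(K.Realization, L.Realization)}
    (hφ : Approximates φ f) (hψ : Approximates ψ f) : φ.faceMap.Homotopic ψ.faceMap := by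
  classical
  refine SimplicialMap.faceMap_homotopic_of_contiguous φ ψ fun s hs => ?_
  refine mem_of_forall_ne_zero (f (barycenter ⟨s, hs⟩))
    (((nonempty_of_mem hs).image _).mono Finset.subset_union_left) fun w hw => ?_
  rcases Finset.mem_union.1 hw with hw | hw <;> obtain ⟨v, hv, rfl⟩ := Finset.mem_image.1 hw
  · exact hφ _ v (barycenter_ne_zero hv)
  · exact hψ _ v (barycenter_ne_zero hv)

/-- A map which sends the open star of each vertex into an open star has a simplicial
approximation. -/
theorem exists_of_openStar (f : C(K.Realization, L.Realization)) (p : K.Vertex → L.Vertex)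
    (h : ∀ v, ∀ x ∈ openStar v, f x ∈ openStar (p v)) :
    ∃ ψ : SimplicialMap K L, ψ.toFun = p ∧ Approximates ψ f := by
  classical
  refine ⟨⟨p, fun s hs => ?_⟩, rfl, fun x v hv => h v x hv⟩
  refine mem_of_forall_ne_zero (f (barycenter ⟨s, hs⟩)) ((nonempty_of_mem hs).image _)
    fun w hw => ?_
  obtain ⟨v, hv, rfl⟩ := Finset.mem_image.1 hw
  exact h v _ (barycenter_ne_zero hv)

end Approximates

/-! ### Iterated subdivisions -/

namespace FinSimplicialComplex

/-- The linear map `|K'| → |K|` which sends each vertex of the subdivision `K'` to the barycenter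
of the corresponding simplex. -/
noncomputable def subdivisionMap (K : FinSimplicialComplex.{u}) :
    C(K.subdivision.Realization, K.Realization) where
  toFun x := ⟨⟨fun v => ∑ s : K.subdivision.Vertex, x.1 s * (barycenter (K := K) s).1 v,
      fun v => Finset.sum_nonneg fun s _ =>
        mul_nonneg (stdSimplex.zero_le _ _) (stdSimplex.zero_le _ _), by
      rw [Finset.sum_comm]
      simp_rw [← Finset.mul_sum, stdSimplex.sum_eq_one, mul_one]
      exact stdSimplex.sum_eq_one x.1⟩, by
    obtain ⟨c, hc, hx⟩ := x.2
    obtain ⟨s, -, hs⟩ := exists_max_of_mem_subdivision hc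
    refine ⟨s.1, s.2, fun v hv => ?_⟩
    obtain ⟨t, -, ht⟩ := Finset.exists_ne_zero_of_sum_ne_zero hv
    refine hs t (hx t (left_ne_zero_of_mul ht)) ?_
    by_contra h
    exact right_ne_zero_of_mul ht (if_neg h)⟩
  continuous_toFun := by
    refine Continuous.subtype_mk (Continuous.subtype_mk (continuous_pi fun v => ?_) _) _
    exact continuous_finsetSum _ fun s _ => (continuous_coord s).mul continuous_const

theorem subdivisionMap_apply (x : K.subdivision.Realization) (v : K.Vertex) :
    (K.subdivisionMap x).1 v =
      ∑ s : K.subdivision.Vertex, x.1 s * (barycenter (K := K) s).1 v := rfl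

/-- If `x` has positive weight at `s`, the barycenter of `s` contributes positively to the
coordinate of every vertex of `s`, in particular the chosen one. -/
theorem approximates_vertexMap (K : FinSimplicialComplex.{u}) :
    Approximates K.vertexMap K.subdivisionMap := by
  intro x s hs
  rw [subdivisionMap_apply]
  refine (Finset.sum_pos' (fun t _ => mul_nonneg (stdSimplex.zero_le _ _)
    (stdSimplex.zero_le _ _)) ⟨s, Finset.mem_univ _, ?_⟩).ne'
  exact mul_pos (lt_of_le_of_ne (stdSimplex.zero_le _ _) hs.symm)
    (lt_of_le_of_ne (stdSimplex.zero_le _ _) (barycenter_ne_zero (vertexMap_mem s)).symm)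

end FinSimplicialComplex

/-- A linear map `|K'| → |K|` with a simplicial approximation whose face map is in `𝒟̄`. -/
structure Refinement (K : FinSimplicialComplex.{u}) where
  complex : FinSimplicialComplex.{u}
  approx : SimplicialMap complex K
  map : C(complex.Realization, K.Realization)
  point : complex.Vertex → K.Realization
  map_apply : ∀ x w, (map x).1 w = ∑ v, x.1 v * (point v).1 w
  approximates : Approximates approx map
  dbar : DBar approx.faceMap

namespace Refinement

/-- The trivial refinement. -/
noncomputable def refl (K : FinSimplicialComplex.{u}) : Refinement K where
  complex := K
  approx := .id K
  map := .id _
  point v := barycenter ⟨{v}, K.toComplex.singleton_mem v⟩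
  map_apply x w := by
    classical
    simp [barycenter_apply]
  approximates := .id K
  dbar := by
    rw [SimplicialMap.faceMap_id]
    exact .id _

/-- The barycentric subdivision of a refinement. -/
noncomputable def subdivide (R : Refinement K) : Refinement K where
  complex := R.complex.subdivision
  approx := R.approx.comp R.complex.vertexMap
  map := R.map.comp R.complex.subdivisionMap
  point s := R.map (barycenter s)
  map_apply x w := by
    simp only [ContinuousMap.comp_apply, map_apply, subdivisionMap_apply, Finset.sum_mul,
      Finset.mul_sum, mul_assoc]
    exact Finset.sum_comm
  approximates := R.approximates.comp R.complex.approximates_vertexMap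
  dbar := (SimplicialMap.dbar_comp_iff R.complex.dbar_vertexMap).2 R.dbar

/-- The mesh of `R` is at most `r`. -/
def MeshLE (R : Refinement K) (r : ℝ) : Prop :=
  ∀ s ∈ R.complex.toComplex, ∀ v ∈ s, ∀ v' ∈ s, ∀ w,
    |(R.point v).1 w - (R.point v').1 w| ≤ r

/-- The simplices of `R` have at most `d` vertices. -/
def CardLE (R : Refinement K) (d : ℕ) : Prop := ∀ s ∈ R.complex.toComplex, s.card ≤ d

/-- The members of a chain have distinct cardinalities between 1 and `d`. This keeps the contraction
factor of the mesh the same at every subdivision. -/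
theorem CardLE.subdivide {R : Refinement K} {d : ℕ} (h : R.CardLE d) : R.subdivide.CardLE d := by
  intro (c : Finset R.complex.Simplex) hc
  have : c.card ≤ (Finset.Icc 1 d).card := by
    refine Finset.card_le_card_of_injOn (fun s => s.1.card) (fun s _ => ?_) fun s hs t ht hst => ?_
    · exact Finset.mem_coe.2 (Finset.mem_Icc.2 ⟨(nonempty_of_mem s.2).card_pos, h _ s.2⟩)
    · rcases hc.2.total hs ht with hle | hle
      · exact Subtype.ext (Finset.eq_of_subset_of_card_le hle hst.ge)
      · exact Subtype.ext (Finset.eq_of_subset_of_card_le hle hst.le).symm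
  exact this.trans_eq (by simp)

theorem map_barycenter (R : Refinement K) (s : R.complex.Simplex) (w : K.Vertex) :
    (R.map (barycenter s)).1 w = (s.1.card : ℝ)⁻¹ * ∑ v ∈ s.1, (R.point v).1 w := by
  classical
  rw [R.map_apply]
  simp [barycenter_apply, Finset.mul_sum, Finset.sum_ite_mem]

/-- The difference of the two averages is the average of `q v - q v'` over pairs in `s × t`. As `s ⊆
t`, for each `v` the term `v' = v` vanishes, which saves a factor `1 - 1/|t|`. -/
theorem MeshLE.abs_barycenter_sub_le {R : Refinement K} {d : ℕ} {r : ℝ} (h : R.MeshLE r)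
    (hd : R.CardLE d) (hr : 0 ≤ r) {s t : R.complex.Simplex} (hst : s ≤ t) (w : K.Vertex) :
    |(R.map (barycenter s)).1 w - (R.map (barycenter t)).1 w| ≤ (1 - (d : ℝ)⁻¹) * r := by
  classical
  have hs := (nonempty_of_mem s.2).card_pos
  have ht := (nonempty_of_mem t.2).card_pos
  have hs' : (0 : ℝ) < s.1.card := by exact_mod_cast hs
  have ht' : (0 : ℝ) < t.1.card := by exact_mod_cast ht
  let q : R.complex.Vertex → ℝ := fun v => (R.point v).1 w
  have key : (R.map (barycenter s)).1 w - (R.map (barycenter t)).1 w =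
      (s.1.card : ℝ)⁻¹ * (t.1.card : ℝ)⁻¹ * ∑ v ∈ s.1, ∑ v' ∈ t.1, (q v - q v') := by
    simp only [map_barycenter, Finset.sum_sub_distrib, Finset.sum_const, nsmul_eq_mul,
      ← Finset.mul_sum]
    field_simp
    rw [mul_comm]
  have bound : |∑ v ∈ s.1, ∑ v' ∈ t.1, (q v - q v')| ≤ s.1.card * ((t.1.card - 1) * r) := by
    refine (Finset.abs_sum_le_sum_abs _ _).trans ?_
    rw [← nsmul_eq_mul]
    refine Finset.sum_le_card_nsmul _ _ _ fun v hv => ?_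
    refine (Finset.abs_sum_le_sum_abs _ _).trans ?_
    rw [← Finset.add_sum_erase _ _ (hst hv), sub_self, abs_zero, zero_add]
    refine (Finset.sum_le_card_nsmul _ _ r fun v' hv' =>
      h t.1 t.2 v (hst hv) v' (Finset.mem_of_mem_erase hv') w).trans_eq ?_
    rw [Finset.card_erase_of_mem (hst hv), nsmul_eq_mul, Nat.cast_sub ht, Nat.cast_one]
  have hdt : (d : ℝ)⁻¹ ≤ (t.1.card : ℝ)⁻¹ :=
    inv_anti₀ ht' (by exact_mod_cast hd _ t.2)
  rw [key, abs_mul, abs_of_pos (by positivity)]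
  calc _ ≤ (s.1.card : ℝ)⁻¹ * (t.1.card : ℝ)⁻¹ * (s.1.card * ((t.1.card - 1) * r)) := by gcongr
    _ = (1 - (t.1.card : ℝ)⁻¹) * r := by field_simp
    _ ≤ _ := by gcongr

theorem MeshLE.subdivide {R : Refinement K} {d : ℕ} {r : ℝ} (h : R.MeshLE r)
    (hd : R.CardLE d) (hr : 0 ≤ r) : R.subdivide.MeshLE ((1 - (d : ℝ)⁻¹) * r) := by
  intro c hc s hs t ht w
  rcases hc.2.total hs ht with hle | hle
  · exact h.abs_barycenter_sub_le hd hr hle w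
  · rw [abs_sub_comm]
    exact h.abs_barycenter_sub_le hd hr hle w

theorem exists_meshLE (K : FinSimplicialComplex.{u}) {ε : ℝ} (hε : 0 < ε) :
    ∃ R : Refinement K, R.MeshLE ε := by
  -- The extra 1 keeps `d` positive when `K` has no vertices.
  let d := Fintype.card K.Vertex + 1
  have hd0 : 0 < (d : ℝ)⁻¹ := by positivity
  have hd1 : (d : ℝ)⁻¹ ≤ 1 := inv_le_one_of_one_le₀ (by simp [d])
  have h : ∀ n : ℕ, ∃ R : Refinement K, R.CardLE d ∧ R.MeshLE ((1 - (d : ℝ)⁻¹) ^ n) := by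
    intro n
    induction n with
    | zero =>
      refine ⟨refl K, fun s _ => (Finset.card_le_univ s).trans (Nat.le_succ _),
        fun s _ v _ v' _ w => ?_⟩
      rw [pow_zero, abs_sub_le_iff]
      have h0 := stdSimplex.zero_le ((refl K).point v).1 w
      have h1 := stdSimplex.le_one ((refl K).point v).1 w
      have h0' := stdSimplex.zero_le ((refl K).point v').1 w
      have h1' := stdSimplex.le_one ((refl K).point v').1 w
      constructor <;> linarith
    | succ n ih =>
      obtain ⟨R, hR, hm⟩ := ih
      refine ⟨R.subdivide, hR.subdivide, ?_⟩
      rw [pow_succ']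
      exact hm.subdivide hR (pow_nonneg (by linarith) n)
  obtain ⟨n, hn⟩ := exists_pow_lt_of_lt_one hε (show 1 - (d : ℝ)⁻¹ < 1 by linarith)
  obtain ⟨R, -, hR⟩ := h n
  exact ⟨R, fun s hs v hv v' hv' w => (hR s hs v hv v' hv' w).trans hn.le⟩

/-- The image of `x` is a convex combination of the points attached to the vertices of a simplex
containing `v`, each within `r` of `R.point v` in the sup metric. -/
theorem MeshLE.dist_map_le {R : Refinement K} {r : ℝ} (h : R.MeshLE r) (hr : 0 ≤ r)
    {v : R.complex.Vertex} {x : R.complex.Realization} (hx : x ∈ openStar v) :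
    dist (R.map x) (R.point v) ≤ r := by
  refine (dist_pi_le_iff hr).2 fun w => ?_
  change |(R.map x).1 w - (R.point v).1 w| ≤ r
  obtain ⟨s, hs, hxs⟩ := x.2
  have : (R.map x).1 w - (R.point v).1 w =
      ∑ v', x.1 v' * ((R.point v').1 w - (R.point v).1 w) := by
    simp only [mul_sub, Finset.sum_sub_distrib, ← Finset.sum_mul, R.map_apply,
      stdSimplex.sum_eq_one, one_mul]
  rw [this]
  calc _ ≤ ∑ v', |x.1 v' * ((R.point v').1 w - (R.point v).1 w)| :=
        Finset.abs_sum_le_sum_abs _ _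
    _ ≤ ∑ v', x.1 v' * r := by
        refine Finset.sum_le_sum fun v' _ => ?_
        rw [abs_mul, abs_of_nonneg (stdSimplex.zero_le _ _)]
        by_cases hv' : x.1 v' = 0
        · simp [hv']
        · exact mul_le_mul_of_nonneg_left (h s hs v' (hxs _ hv') v (hxs _ hx) w)
            (stdSimplex.zero_le _ _)
    _ = r := by rw [← Finset.sum_mul, stdSimplex.sum_eq_one, one_mul]

/-- Every open cover of `|K|` has a refinement whose map sends each open star into a member of the
cover. -/
theorem exists_openStar_subset {ι : Type*} (U : ι → Set K.Realization) (hU : ∀ i, IsOpen (U i))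
    (hcov : ∀ x, ∃ i, x ∈ U i) :
    ∃ R : Refinement K, ∀ v, ∃ i, ∀ x ∈ openStar v, R.map x ∈ U i := by
  obtain ⟨δ, hδ, h⟩ := lebesgue_number_lemma_of_metric isCompact_univ hU
    fun x _ => Set.mem_iUnion.2 (hcov x)
  obtain ⟨R, hR⟩ := exists_meshLE K (half_pos hδ)
  refine ⟨R, fun v => ?_⟩
  obtain ⟨i, hi⟩ := h (R.point v) trivial
  exact ⟨i, fun x hx => hi ((hR.dist_map_le (half_pos hδ).le hx).trans_lt (half_lt_self hδ))⟩

/-- Two maps which are close enough have a common simplicial approximation on a refinement. -/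
theorem exists_approximates (f g : C(K.Realization, L.Realization))
    (h : ∀ x, ∃ w, f x ∈ openStar w ∧ g x ∈ openStar w) :
    ∃ (R : Refinement K) (ψ : SimplicialMap R.complex L),
      Approximates ψ (f.comp R.map) ∧ Approximates ψ (g.comp R.map) := by
  obtain ⟨R, hR⟩ := exists_openStar_subset (fun w => f ⁻¹' openStar w ∩ g ⁻¹' openStar w)
    (fun w => ((isOpen_openStar w).preimage f.continuous).inter
      ((isOpen_openStar w).preimage g.continuous)) h
  choose p hp using hR
  obtain ⟨ψ, rfl, hψ⟩ := Approximates.exists_of_openStar (f.comp R.map) p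
    fun v x hx => (hp v x hx).1
  exact ⟨R, ψ, hψ, fun x v hx => (hp v x hx).2⟩

end Refinement

open FinSimplicialComplex

variable {K L M : FinSimplicialComplex.{u}}

/-! ### Maps of realizations with simplicial approximations in `𝒟̄` -/

/-- `f : |K| → |L|` is approximated, after some refinement of `K`, by a simplicial map whose face
map is in `𝒟̄`. -/
def HasDBarApprox (f : C(K.Realization, L.Realization)) : Prop :=
  ∃ (P : FinSimplicialComplex.{u}) (α : SimplicialMap P K) (h : C(P.Realization, K.Realization))
    (ψ : SimplicialMap P L),
    DBar α.faceMap ∧ Approximates α h ∧ DBar ψ.faceMap ∧ Approximates ψ (f.comp h)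

namespace HasDBarApprox

theorem of_approximates {f : C(K.Realization, L.Realization)} {ψ : SimplicialMap K L}
    (hψ : DBar ψ.faceMap) (h : Approximates ψ f) : HasDBarApprox f :=
  ⟨K, .id K, .id _, ψ, by rw [SimplicialMap.faceMap_id]; exact .id _, .id K, hψ, h⟩

/-- Both `θ` and `ψ ∘ α` approximate `f ∘ a`, so their face maps are homotopic; then `𝒳(α)` cancels.
-/
theorem dbar {f : C(K.Realization, L.Realization)} (hf : HasDBarApprox f) {ψ : SimplicialMap K L}
    (h : Approximates ψ f) : DBar ψ.faceMap := by
  obtain ⟨P, α, a, θ, hα, haα, hθ, hfθ⟩ := hf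
  exact (SimplicialMap.dbar_comp_iff hα).1
    (hθ.of_homotopic (hfθ.faceMap_homotopic (h.comp haα)))

/-- A common approximation of `f ∘ a` and `g ∘ a` on a refinement of `P` can be compared with `θ`
through `f`, and then serves `g`. -/
theorem of_close {f g : C(K.Realization, L.Realization)} (hf : HasDBarApprox f)
    (h : ∀ x, ∃ w, f x ∈ openStar w ∧ g x ∈ openStar w) : HasDBarApprox g := by
  obtain ⟨P, α, a, θ, hα, haα, hθ, hfθ⟩ := hf
  obtain ⟨R, ψ, hfψ, hgψ⟩ := Refinement.exists_approximates (f.comp a) (g.comp a)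
    fun x => h (a x)
  exact ⟨R.complex, α.comp R.approx, a.comp R.map, ψ,
    (SimplicialMap.dbar_comp_iff R.dbar).2 hα, haα.comp R.approximates,
    ((SimplicialMap.dbar_comp_iff R.dbar).2 hθ).of_homotopic
      ((hfθ.comp R.approximates).faceMap_homotopic hfψ), hgψ⟩

theorem of_homotopic {f g : C(K.Realization, L.Realization)} (hf : HasDBarApprox f)
    (h : f.Homotopic g) : HasDBarApprox g := by
  obtain ⟨H⟩ := h
  obtain ⟨δ, hδ, hδL⟩ := lebesgue_number_lemma_of_metric (isCompact_univ (X := L.Realization))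
    isOpen_openStar fun x _ => Set.mem_iUnion.2 (exists_mem_openStar x)
  -- The homotopy becomes a path in the uniform metric. Since `δ` is a Lebesgue number for the open
  -- stars of `L`, maps at distance less than `δ` send each point into a common star.
  let F : C(unitInterval, C(K.Realization, L.Realization)) := H.toContinuousMap.curry
  have hF : IsLocallyConstant fun t => HasDBarApprox (F t) := by
    refine (IsLocallyConstant.iff_eventually_eq _).2 fun t => ?_
    filter_upwards [F.continuous.continuousAt (Metric.ball_mem_nhds (F t) hδ)] with t' ht'
    have key : ∀ x, ∃ w, F t x ∈ openStar w ∧ F t' x ∈ openStar w := fun x => by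
      obtain ⟨w, hw⟩ := hδL (F t x) trivial
      exact ⟨w, hw (Metric.mem_ball_self hδ),
        hw ((ContinuousMap.dist_apply_le_dist x).trans_lt ht')⟩
    exact propext ⟨fun h => h.of_close fun x => (key x).imp fun _ => And.symm,
      fun h => h.of_close key⟩
  have h0 : F 0 = f := by ext1 x; exact H.apply_zero x
  have h1 : F 1 = g := by ext1 x; exact H.apply_one x
  have h01 := hF.apply_eq_of_preconnectedSpace 0 1
  simp only [h0, h1] at h01
  exact h01.mp hf

theorem realization_comp {f : C(K.Realization, L.Realization)} (hf : HasDBarApprox f)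
    {φ : SimplicialMap L M} (hφ : DBar φ.faceMap) : HasDBarApprox (φ.realization.comp f) := by
  obtain ⟨P, α, a, θ, hα, haα, hθ, hfθ⟩ := hf
  refine ⟨P, α, a, φ.comp θ, hα, haα, (SimplicialMap.dbar_comp_iff hθ).2 hφ, ?_⟩
  rw [ContinuousMap.comp_assoc]
  exact (Approximates.realization φ).comp hfθ

/-- If `ψ` approximates `g ∘ f ∘ a` on a refinement, then `φ ∘ ψ` approximates `|φ| ∘ g ∘ f ∘ a`,
which is homotopic to `f ∘ a`. Homotopy invariance puts `𝒳(φ ∘ ψ)` in `𝒟̄`, and `𝒳(φ)` cancels. -/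
theorem homotopyInverse_comp {f : C(K.Realization, L.Realization)} (hf : HasDBarApprox f)
    {φ : SimplicialMap M L} (hφ : DBar φ.faceMap) {g : C(L.Realization, M.Realization)}
    (hg : IsHomotopyInverse g φ.realization) : HasDBarApprox (g.comp f) := by
  obtain ⟨P, α, a, θ, hα, haα, hθ, hfθ⟩ := hf
  -- With both maps equal this is the ordinary simplicial approximation theorem.
  obtain ⟨R, ψ, hψ, -⟩ := Refinement.exists_approximates (g.comp (f.comp a)) (g.comp (f.comp a))
    fun x => (exists_mem_openStar _).imp fun _ h => ⟨h, h⟩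
  have h1 : HasDBarApprox ((f.comp a).comp R.map) :=
    .of_approximates ((SimplicialMap.dbar_comp_iff R.dbar).2 hθ) (hfθ.comp R.approximates)
  have h2 : HasDBarApprox (φ.realization.comp ((g.comp (f.comp a)).comp R.map)) :=
    h1.of_homotopic (hg.2.symm.comp (.refl ((f.comp a).comp R.map)))
  have h3 : DBar (φ.comp ψ).faceMap := h2.dbar ((Approximates.realization φ).comp hψ)
  rw [SimplicialMap.faceMap_comp] at h3
  exact ⟨R.complex, α.comp R.approx, a.comp R.map, ψ, (SimplicialMap.dbar_comp_iff R.dbar).2 hα,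
    haα.comp R.approximates, hφ.of_comp_right h3, hψ⟩

end HasDBarApprox

theorem hasDBarApprox_chainComp (n : ℕ) (K : Fin (n + 1) → FinSimplicialComplex.{u})
    (f : ∀ i : Fin n, C((K i.castSucc).Realization, (K i.succ).Realization))
    (hf : ∀ i : Fin n,
      (∃ φ : SimplicialMap (K i.castSucc) (K i.succ),
        DBar φ.faceMap ∧ f i = φ.realization) ∨
      (∃ φ : SimplicialMap (K i.succ) (K i.castSucc),
        DBar φ.faceMap ∧ IsHomotopyInverse (f i) φ.realization)) :
    HasDBarApprox (chainComp n (fun i => (K i).Realization) f) := by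
  induction n with
  | zero => exact .of_approximates (by rw [SimplicialMap.faceMap_id]; exact .id _) (.id (K 0))
  | succ n ih =>
    have h := ih (fun i => K i.castSucc) (fun i => f i.castSucc) fun i => hf i.castSucc
    rcases hf (Fin.last n) with ⟨φ, hφ, hfφ⟩ | ⟨φ, hφ, hfφ⟩
    · have := h.realization_comp hφ
      rw [← hfφ] at this
      exact this
    · exact h.homotopyInverse_comp hφ hfφ

theorem mainTheorem3 (n : ℕ) (K : Fin (n + 1) → FinSimplicialComplex.{u})
    (f : ∀ i : Fin n, C((K i.castSucc).Realization, (K i.succ).Realization))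
    (hf : ∀ i : Fin n,
      (∃ φ : SimplicialMap (K i.castSucc) (K i.succ),
        DBar φ.faceMap ∧ f i = φ.realization) ∨
      (∃ φ : SimplicialMap (K i.succ) (K i.castSucc),
        DBar φ.faceMap ∧ IsHomotopyInverse (f i) φ.realization))
    (φ : SimplicialMap (K 0) (K (Fin.last n)))
    (hφ : φ.realization.Homotopic (chainComp n (fun i => (K i).Realization) f)) :
    DBar φ.faceMap := by
  exact ((hasDBarApprox_chainComp n K f hf).of_homotopic hφ.symm).dbar (.realization φ)
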